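/- Let $G$ be a second countable compact Hausdorff group with normalized Haar measure $dg$, acting measurably on a measurable space $T$, and let $m$ be a $G$-invariant $\sigma$-finite measure on $T$. Let $\widehat G$ be the set of equivalence classes of irreducible (finite-dimensional, continuous, unitary) complex representations of $G$; for $[\pi]\in\widehat G$ let $d_\pi$ and $\chi_\pi$ be its dimension and character, $[\pi^*]$ the class of the dual representation, and put $$f^{\pi}(t)=d_\pi\int_G\chi_\pi(g)\,f(g^{-1}\cdot t)\,dg .$$ Let $X=\{X(t):t\in T\}$ be a jointly measurable, centered real Gaussian process on a probability space $(\Omega,\mathcal F,\mathbf P)$ whose paths all lie in $L^2(T,m)$, with covariance function $R$. Let $\lambda_1>\lambda_2>\dots>0$ be the (finite or infinite) sequence of all positive eigenvalues of the integral operator with kernel $R$ on the complex space $L^2(T,m)$, $E_j$ the eigenspace of $\lambda_j$, $n_j=\dim E_j<\infty$, and $(f_{j,1},\dots,f_{j,n_j})$ measurable functions forming an orthonormal basis of $E_j$. Assume that there are i.i.d. $N(0,1)$ variables $\xi_{j,l}$ such that, almost surely, $X_N(t)=\sum_{j\le N}\sqrt{\lambda_j}\sum_{l=1}^{n_j}\xi_{j,l}f_{j,l}(t)$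 converges to $X$ in $L^2(T,m)$, and that for all $\omega,t,j,l$ the functions $g\mapsto X(\omega,g\cdot t)$ and $g\mapsto f_{j,l}(g\cdot t)$ are in $L^2(G,dg)$. Let $X_N^\pi$ and $X^\pi$ be obtained by applying $f\mapsto f^\pi$ to the paths of $X_N$ and $X$. Then: 1. For each $[\pi]\in\widehat G$, almost surely, $X_N^{\pi}$ and $X^\pi$ have paths in $L^2(T,m)$ and $X_N^{\pi}\to X^{\pi}$ in $L^2(T,m)$ as $N\to\infty$. 2. If the law of $X$ (its finite-dimensional distributions) is $G$-invariant, then for each $j$ the space $E_j$ is stable under $f\mapsto f(g^{-1}\cdot\,)$, $g\in G$, and this defines a continuous finite-dimensional representation of $G$ on $E_j$. 3. Suppose the law of $X$ is $G$-invariant. Then for each $j$ the space $E_j$ has a canonical decomposition $E_j=E_j^1\oplus\dots\oplus E_j^{h_j}$, where $E_j^l\neq 0$ is the sum of all subrepresentations of $E_j$ equivalent to $\pi_{j,l}$ and $[\pi_{j,1}],\dots,[\pi_{j,h_j}]\in\widehat G$ are distinct. For every such decomposition, $1\le h_j\le n_j$, the spaces $E_j^l$ are mutually orthogonal in $L^2(T,m)$,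 and for every $[\pi]\in\widehat G$ and $f\in E_j$ the function $f^\pi$ is in $L^2(T,m)$ (the integral converging absolutely for $m$-a.e. $t$), and, $m$-almost everywhere, $f^\pi=0$ if $[\pi^*]\ne[\pi_{j,l}]$ for every $l$, while $f^\pi$ is the projection of $f$ on $E_j^l$ if $[\pi^*]=[\pi_{j,l}]$. In particular, if $\chi_\pi$ is real-valued, $f^\pi=0$ if $[\pi]\neq[\pi_{j,l}]$ for every $l$, and $f^\pi$ is the projection of $f$ on $E_j^l$ if $[\pi]=[\pi_{j,l}]$. -/

import Mathlib

open MeasureTheory ProbabilityTheory Filter Topology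

open scoped ENNReal BoundedContinuousFunction

noncomputable section

namespace KLProjection

/-- A finite-dimensional, continuous, unitary, irreducible complex representation of the
topological group `G`, realised on some `ℂᵈ` with its Hermitian inner product (an orthonormal
basis having been chosen). Every class in the dual of a compact group has such a
representative; two representations lie in the same class when `Equivalent` holds. -/
structure UnitaryIrrep (G : Type*) [Group G] [TopologicalSpace G] where
  /-- The dimension of the representation. -/
  dim : ℕ
  /-- The underlying homomorphism. -/
  rep : Representation ℂ G (EuclideanSpace ℂ (Fin dim))
  continuous_rep : Continuous fun p : G × EuclideanSpace ℂ (Fin dim) => rep p.1 p.2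
  norm_rep : ∀ g v, ‖rep g v‖ = ‖v‖
  irreducible_rep : rep.IsIrreducible

/-- Equivalence of representations. -/
def Equivalent {G V W : Type*} [Group G] [AddCommGroup V] [Module ℂ V] [AddCommGroup W]
    [Module ℂ W] (ρ : Representation ℂ G V) (σ : Representation ℂ G W) : Prop :=
  Nonempty (ρ.Equiv σ)

/-- The isotypic component of `ρ` of type `σ`: the sum of all subrepresentations of `ρ` that are
equivalent to `σ`. -/
def isotypic {G V W : Type*} [Group G] [AddCommGroup V] [Module ℂ V] [AddCommGroup W]
    [Module ℂ W] (ρ : Representation ℂ G V) (σ : Representation ℂ G W) : Submodule ℂ V :=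
  sSup {U | ∃ S : Subrepresentation ρ, S.toSubmodule = U ∧ Equivalent S.toRepresentation σ}

/-- The canonical decomposition of a representation: the family `τ` lists, without repetition,
irreducible representations that occur in `ρ`, and the space of `ρ` is the direct sum of the
corresponding isotypic components. -/
structure IsCanonicalDecomposition {G V : Type*} [Group G] [TopologicalSpace G] [AddCommGroup V]
    [Module ℂ V] (ρ : Representation ℂ G V) {h : ℕ} (τ : Fin h → UnitaryIrrep G) : Prop where
  inequivalent : ∀ k l, k ≠ l → ¬ Equivalent (τ k).rep (τ l).rep
  ne_bot : ∀ l, isotypic ρ (τ l).rep ≠ ⊥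
  isInternal : DirectSum.IsInternal fun l => isotypic ρ (τ l).rep

section Action

variable {G T : Type*} [Group G] [MulAction G T] [MeasurableSpace T]

/-- The function `f^π (t) = d_π ∫ χ_π(g) f(g⁻¹ • t) dg`. -/
def charProj [TopologicalSpace G] [MeasurableSpace G] (dg : Measure G) (π : UnitaryIrrep G)
    (f : T → ℂ) (t : T) : ℂ :=
  (π.dim : ℂ) * ∫ g, π.rep.character g * f (g⁻¹ • t) ∂dg

/-- The left translation `f ↦ f(g⁻¹ • ·)` on `L²(m)`, for a `G`-invariant measure `m`. -/
def translation (m : Measure T) [MeasurableConstSMul G T] [SMulInvariantMeasure G T m] :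
    Representation ℂ G (Lp ℂ 2 m) where
  toFun g := Lp.compMeasurePreservingₗ ℂ (fun t => g⁻¹ • t) (measurePreserving_smul g⁻¹ m)
  map_one' := by
    ext1 f
    have h : (DomMulAct.mk (1 : G)⁻¹) • f = f := by simp
    exact h
  map_mul' a b := by
    ext1 f
    have h : (DomMulAct.mk (a * b)⁻¹) • f = DomMulAct.mk a⁻¹ • DomMulAct.mk b⁻¹ • f := by
      rw [smul_smul, ← DomMulAct.mk_mul, mul_inv_rev]
    exact h

end Action

/-- The space of all `f ∈ L²(m)` with `∫ K(t, s) f(s) m(ds) = r f(t)` for almost every `t`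
(the integral being absolutely convergent). -/
def kernelEigenspace {T : Type*} [MeasurableSpace T] (m : Measure T) (K : T → T → ℝ) (r : ℝ) :
    Submodule ℂ (Lp ℂ 2 m) where
  carrier := {f | ∀ᵐ t ∂m, Integrable (fun s => (K t s : ℂ) * f s) m ∧
    ∫ s, (K t s : ℂ) * f s ∂m = (r : ℂ) * f t}
  zero_mem' := by
    have h0 := Lp.coeFn_zero ℂ 2 m
    filter_upwards [h0] with t ht
    have e : (fun s => (K t s : ℂ) * (0 : Lp ℂ 2 m) s) =ᵐ[m] fun _ => 0 := by
      filter_upwards [h0] with s hs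
      rw [hs, Pi.zero_apply, mul_zero]
    refine ⟨(integrable_congr e).2 (integrable_zero _ _ _), ?_⟩
    rw [integral_congr_ae e, ht, Pi.zero_apply, mul_zero, integral_zero]
  add_mem' := by
    intro f f' hf hf'
    rw [Set.mem_ofPred_eq] at hf hf' ⊢
    have h0 := Lp.coeFn_add f f'
    filter_upwards [h0, hf, hf'] with t ht h1 h2
    have e : (fun s => (K t s : ℂ) * (f + f' : Lp ℂ 2 m) s) =ᵐ[m]
        fun s => (K t s : ℂ) * f s + (K t s : ℂ) * f' s := by
      filter_upwards [h0] with s hs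
      rw [hs, Pi.add_apply, mul_add]
    refine ⟨(integrable_congr e).2 (h1.1.add h2.1), ?_⟩
    rw [integral_congr_ae e, integral_add h1.1 h2.1, h1.2, h2.2, ht, Pi.add_apply, mul_add]
  smul_mem' := by
    intro c f hf
    rw [Set.mem_ofPred_eq] at hf ⊢
    have h0 := Lp.coeFn_smul c f
    filter_upwards [h0, hf] with t ht h1
    have e : (fun s => (K t s : ℂ) * (c • f : Lp ℂ 2 m) s) =ᵐ[m]
        fun s => c * ((K t s : ℂ) * f s) := by
      filter_upwards [h0] with s hs
      simp only [hs, Pi.smul_apply, smul_eq_mul]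
      ring
    refine ⟨(integrable_congr e).2 (h1.1.const_mul c), ?_⟩
    rw [integral_congr_ae e, integral_const_mul, h1.2, ht, Pi.smul_apply, smul_eq_mul]
    ring

/-- `lam 0 > lam 1 > ... > 0` is the (finite or infinite) sequence of all positive eigenvalues of
the kernel `K` with respect to `m`, `n j` is the dimension of the eigenspace of `lam j`, and
`(f j l)_l` are measurable functions whose classes form an orthonormal basis of that eigenspace.
If `K` has only `p` distinct positive eigenvalues, then `n j = 0` for `j ≥ p`, and `lam j` has no
meaning for these `j`. -/
structure IsPositiveSpectrum {T : Type*} [MeasurableSpace T] (m : Measure T) (K : T → T → ℝ)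
    (lam : ℕ → ℝ) (n : ℕ → ℕ) (f : (j : ℕ) → Fin (n j) → T → ℂ) : Prop where
  initial : ∀ j, n (j + 1) ≠ 0 → n j ≠ 0
  lam_pos : ∀ j, n j ≠ 0 → 0 < lam j
  lam_lt : ∀ j, n (j + 1) ≠ 0 → lam (j + 1) < lam j
  exhaust : ∀ r : ℝ, 0 < r → (kernelEigenspace m K r ≠ ⊥ ↔ ∃ j, n j ≠ 0 ∧ lam j = r)
  measurable : ∀ j l, Measurable (f j l)
  memLp : ∀ j l, MemLp (f j l) 2 m
  orthonormal : ∀ j, Orthonormal ℂ fun l => (memLp j l).toLp (f j l)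
  span_eq : ∀ j, n j ≠ 0 →
    Submodule.span ℂ (Set.range fun l => (memLp j l).toLp (f j l)) = kernelEigenspace m K (lam j)

section RandomFunctions

variable {Ω T : Type*} [MeasurableSpace Ω] [MeasurableSpace T]

/-- The covariance function of a centered real process. -/
def covKernel (P : Measure Ω) (X : Ω → T → ℝ) (s t : T) : ℝ :=
  ∫ ω, X ω s * X ω t ∂P

/-- The truncated expansion `X_N(t) = ∑_{j < N} √λ_j ∑_l ξ_{j,l} f_{j,l}(t)` (indices start
at `0`). -/
def klTruncation (lam : ℕ → ℝ) (n : ℕ → ℕ) (f : (j : ℕ) → Fin (n j) → T → ℂ)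
    (ξ : (j : ℕ) → Fin (n j) → Ω → ℝ) (N : ℕ) (ω : Ω) (t : T) : ℂ :=
  ∑ j ∈ Finset.range N, (Real.sqrt (lam j) : ℂ) * ∑ l, (ξ j l ω : ℂ) * f j l t

/-- The Karhunen–Loève expansion: the coefficients `ξ` are i.i.d. standard Gaussian random
variables, and almost surely the truncations converge to `X` in `L²(m)`. -/
structure IsKLExpansion (P : Measure Ω) (m : Measure T) (X : Ω → T → ℝ) (lam : ℕ → ℝ) (n : ℕ → ℕ)
    (f : (j : ℕ) → Fin (n j) → T → ℂ) (ξ : (j : ℕ) → Fin (n j) → Ω → ℝ) : Prop where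
  hasLaw : ∀ j l, HasLaw (ξ j l) (gaussianReal 0 1) P
  indep : iIndepFun (fun p : (j : ℕ) × Fin (n j) => ξ p.1 p.2) P
  tendsto : ∀ᵐ ω ∂P, Tendsto
    (fun N => eLpNorm (fun t => klTruncation lam n f ξ N ω t - (X ω t : ℂ)) 2 m) atTop (𝓝 0)

/-- The law of the process `X` is invariant under the action of `G` on the index set. -/
def IsInvariantLaw (G : Type*) [Group G] [MulAction G T] (P : Measure Ω) (X : Ω → T → ℝ) : Prop :=
  ∀ (k : ℕ) (φ : (Fin k → ℝ) →ᵇ ℝ) (g : G) (t : Fin k → T),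
    ∫ ω, φ (fun i => X ω (t i)) ∂P = ∫ ω, φ (fun i => X ω (g • t i)) ∂P

end RandomFunctions

/-- Let `ρ` be the subrepresentation of `L²(m)` with canonical decomposition `τ`, and let `x` be a
vector of its space. `F` vanishes if `σ` is equivalent to none of the `τ l`, and `F` is the
component of `x` in the isotypic component of type `τ l` if `σ` is equivalent to `τ l`. -/
def IsTypeComponent {G T W : Type*} [Group G] [TopologicalSpace G] [MeasurableSpace T]
    {m : Measure T} {L : Representation ℂ G (Lp ℂ 2 m)} (E : Subrepresentation L) {h : ℕ}
    (τ : Fin h → UnitaryIrrep G) [AddCommGroup W] [Module ℂ W] (σ : Representation ℂ G W)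
    (x : E.toSubmodule) (F : T → ℂ) : Prop :=
  ((∀ l, ¬ Equivalent σ (τ l).rep) → F =ᵐ[m] 0) ∧
  ∀ l, Equivalent σ (τ l).rep →
    ∀ u : Fin h → E.toSubmodule, (∀ k, u k ∈ isotypic E.toRepresentation (τ k).rep) →
      x = ∑ k, u k → F =ᵐ[m] ((u l : Lp ℂ 2 m) : T → ℂ)

end KLProjection

end

open KLProjection

/-! The map `f ↦ f^π` is bounded on `L²(m)`. As `dg` is a probability measure, `|f^π(t)|` is at most
`d_π sup |χ_π|` times the `L²(dg)` norm of `g ↦ f(g⁻¹ • t)`. Squaring and integrating over `t`,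
Tonelli and the invariance of `m` give back `‖f‖²` (`exists_eLpNorm_charProj_le`). So the
convergence of `X_N` passes to `X_N^π` on the same almost sure event.

An invariant law has an invariant covariance, so translations preserve each eigenspace `E_j`
(`translation_mem_kernelEigenspace`). They act isometrically and, by Fubini, measurably; on a
compact group this forces continuity (`continuous_apply_of_stronglyMeasurable`).

On `E_j`, a continuous finite-dimensional unitary representation, Schur's lemma applied to averages
of rank-one maps shows that `d_σ ∫ χ_σ(g⁻¹) ρ(g) dg` is the identity on the isotypic component of
type `σ` and zero on the others. Since `χ_π(g) = χ_{π*}(g⁻¹)`, the map `f ↦ f^π` is this operator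
for `σ = π*`, once the pointwise integral is identified with the integral in `E_j`
(`integral_mul_inv_smul_ae_eq`). -/

namespace Representation

/-! ### Irreducibility, duals and characters without topology. -/

section Algebra

variable {k G V W : Type*} [Field k] [Group G] [AddCommGroup V] [Module k V] [AddCommGroup W]
  [Module k W]

theorem isIrreducible_iff_submodule (ρ : Representation k G V) :
    ρ.IsIrreducible ↔ Nontrivial V ∧
      ∀ U : Submodule k V, (∀ g, ∀ v ∈ U, ρ g v ∈ U) → U = ⊥ ∨ U = ⊤ := by
  constructor
  · intro h
    constructor
    · by_contra hV
      rw [not_nontrivial_iff_subsingleton] at hV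
      apply bot_ne_top (α := Subrepresentation ρ)
      exact Subrepresentation.toSubmodule_injective (Subsingleton.elim _ _)
    · intro U hU
      rcases eq_bot_or_eq_top (⟨U, fun g v hv => hU g v hv⟩ : Subrepresentation ρ) with h1 | h1
      · exact .inl (congrArg Subrepresentation.toSubmodule h1)
      · exact .inr (congrArg Subrepresentation.toSubmodule h1)
  · rintro ⟨hV, h⟩
    exact
      { exists_pair_ne := ⟨⊥, ⊤, fun e => bot_ne_top (α := Submodule k V)
          (congrArg Subrepresentation.toSubmodule e)⟩
        eq_bot_or_eq_top := fun S => by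
          rcases h S.toSubmodule (fun g v hv => S.apply_mem_toSubmodule g hv) with h1 | h1
          · exact .inl (Subrepresentation.toSubmodule_injective h1)
          · exact .inr (Subrepresentation.toSubmodule_injective h1) }

theorem Equiv.apply_rep {ρ : Representation k G V} {σ : Representation k G W} (φ : ρ.Equiv σ)
    (g : G) (v : V) : φ (ρ g v) = σ g (φ v) :=
  IntertwiningMap.isIntertwining ρ σ φ.toIntertwiningMap g v

theorem IsIrreducible.of_equiv {ρ : Representation k G V} {σ : Representation k G W}
    (φ : ρ.Equiv σ) (h : ρ.IsIrreducible) : σ.IsIrreducible := by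
  rw [isIrreducible_iff_submodule] at h ⊢
  obtain ⟨hV, h⟩ := h
  refine ⟨φ.toLinearEquiv.symm.toEquiv.nontrivial, fun U hU => ?_⟩
  have hc : (U.comap φ.toLinearEquiv.toLinearMap).map φ.toLinearEquiv.toLinearMap = U :=
    Submodule.map_comap_eq_of_surjective φ.toLinearEquiv.surjective U
  rcases h (U.comap φ.toLinearEquiv.toLinearMap) (fun g v hv => by
    have := hU g _ hv
    change φ (ρ g v) ∈ U
    rw [φ.apply_rep]
    exact this) with h1 | h1
  · left
    rw [← hc, h1, Submodule.map_bot]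
  · right
    rw [← hc, h1, Submodule.map_top]
    exact LinearMap.range_eq_top.2 φ.toLinearEquiv.surjective

/-- The coannihilator of a stable subspace of the dual is stable, hence `⊥` or `⊤`, and in finite
dimension the subspace is recovered as its annihilator. -/
theorem IsIrreducible.dual [FiniteDimensional k V] {ρ : Representation k G V}
    (h : ρ.IsIrreducible) : ρ.dual.IsIrreducible := by
  rw [isIrreducible_iff_submodule] at h ⊢
  obtain ⟨hV, h⟩ := h
  refine ⟨inferInstance, fun U hU => ?_⟩
  have hU' : U.dualCoannihilator.dualAnnihilator = U :=
    Subspace.dualCoannihilator_dualAnnihilator_eq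
  rcases h U.dualCoannihilator (fun g v hv => by
    rw [Submodule.mem_dualCoannihilator] at hv ⊢
    intro φ hφ
    have := hv _ (hU g⁻¹ φ hφ)
    simpa [dual_apply, Module.Dual.transpose_apply] using this) with h1 | h1
  · right
    rw [← hU', h1, Submodule.dualAnnihilator_bot]
  · left
    rw [← hU', h1, Submodule.dualAnnihilator_top]

theorem character_eq_sum_coord (ρ : Representation k G V) {ι : Type*} [Fintype ι]
    (b : Module.Basis ι k V) (g : G) : ρ.character g = ∑ i, b.coord i (ρ g (b i)) := by
  classical
  rw [character, LinearMap.trace_eq_matrix_trace k b, Matrix.trace]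
  simp [LinearMap.toMatrix_apply]

end Algebra

/-! ### Continuity of matrix coefficients. -/

section ContinuousCoeff

variable {G V W : Type*} [Group G] [TopologicalSpace G]
  [AddCommGroup V] [Module ℂ V]
  [NormedAddCommGroup W] [NormedSpace ℂ W] [FiniteDimensional ℂ W]

/-- All matrix coefficients of `ρ` are continuous. -/
def ContinuousCoeff (ρ : Representation ℂ G V) : Prop :=
  ∀ (ℓ : Module.Dual ℂ V) (v : V), Continuous fun g => ℓ (ρ g v)

theorem continuousCoeff_of_continuous {σ : Representation ℂ G W}
    (h : ∀ w, Continuous fun g => σ g w) : σ.ContinuousCoeff := fun ℓ v =>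
  ℓ.continuous_of_finiteDimensional.comp (h v)

theorem ContinuousCoeff.continuous {σ : Representation ℂ G W} (h : σ.ContinuousCoeff) (w : W) :
    Continuous fun g => σ g w := by
  let b := Module.finBasis ℂ W
  have : (fun g => σ g w) = fun g => ∑ i, b.coord i (σ g w) • b i := by
    funext g
    simp
  rw [this]
  exact continuous_finsetSum _ fun i _ => (h _ _).smul continuous_const

theorem ContinuousCoeff.character [FiniteDimensional ℂ V] {ρ : Representation ℂ G V}
    (h : ρ.ContinuousCoeff) : Continuous ρ.character := by
  have : ρ.character = fun g => ∑ i, (Module.finBasis ℂ V).coord i (ρ g (Module.finBasis ℂ V i)) :=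
    funext fun g => ρ.character_eq_sum_coord _ g
  rw [this]
  exact continuous_finsetSum _ fun i _ => h _ _

variable [IsTopologicalGroup G]

-- Continuity through coefficients needs no topology on the space, so it makes sense on
-- `Module.Dual`. A functional on the dual is evaluation at a vector, so the coefficients are those
-- of `ρ` at `g⁻¹`.
omit [NormedSpace ℂ W] [FiniteDimensional ℂ W] [NormedAddCommGroup W] in
theorem ContinuousCoeff.dual [FiniteDimensional ℂ V] {ρ : Representation ℂ G V}
    (h : ρ.ContinuousCoeff) : ρ.dual.ContinuousCoeff := by
  intro ℓ φ
  obtain ⟨v, rfl⟩ := (Module.evalEquiv ℂ V).surjective ℓ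
  have := (h φ v).comp continuous_inv
  simpa [dual_apply, Module.Dual.transpose_apply, Function.comp_def] using this

/-- `V` has no topology; a basis of `W` splits the expression into coefficients of `ρ` times orbit
maps of `σ`. -/
theorem continuous_conj_apply {ρ : Representation ℂ G V} {σ : Representation ℂ G W}
    (hρ : ρ.ContinuousCoeff) (hσ : σ.ContinuousCoeff) (B : V →ₗ[ℂ] W) (v : V) :
    Continuous fun g => σ g (B (ρ g⁻¹ v)) := by
  let b := Module.finBasis ℂ W
  have : (fun g => σ g (B (ρ g⁻¹ v))) =
      fun g => ∑ i, (b.coord i ∘ₗ B) (ρ g⁻¹ v) • σ g (b i) := by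
    funext g
    conv_lhs => rw [← b.sum_repr (B (ρ g⁻¹ v))]
    simp only [map_sum, map_smul]
    rfl
  rw [this]
  exact continuous_finsetSum _ fun i _ =>
    ((hρ _ v).comp continuous_inv).smul (hσ.continuous _)

end ContinuousCoeff

theorem _root_.Continuous.integrable_of_compactSpace {X E : Type*} [TopologicalSpace X]
    [CompactSpace X] [MeasurableSpace X] [OpensMeasurableSpace X] [NormedAddCommGroup E]
    {μ : Measure X} [IsFiniteMeasureOnCompacts μ] {F : X → E} (hF : Continuous F) :
    Integrable F μ :=
  hF.integrable_of_hasCompactSupport (HasCompactSupport.of_compactSpace _)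

/-! ### Averaging over the group and Schur orthogonality. -/

section Average

variable {G V W : Type*} [Group G] [TopologicalSpace G] [IsTopologicalGroup G] [CompactSpace G]
  [MeasurableSpace G] [BorelSpace G] [AddCommGroup V] [Module ℂ V]
  [NormedAddCommGroup W] [NormedSpace ℂ W] [FiniteDimensional ℂ W]
  (dg : Measure G) [dg.IsHaarMeasure]

/-- The average `∫ σ(g) B ρ(g)⁻¹ dg` of a linear map `B`, an intertwining map. -/
noncomputable def average {ρ : Representation ℂ G V} {σ : Representation ℂ G W}
    (hρ : ρ.ContinuousCoeff) (hσ : σ.ContinuousCoeff) (B : V →ₗ[ℂ] W) : ρ.IntertwiningMap σ where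
  toFun v := ∫ g, σ g (B (ρ g⁻¹ v)) ∂dg
  map_add' v w := by
    simp only [map_add]
    exact integral_add (continuous_conj_apply hρ hσ B v).integrable_of_compactSpace
      (continuous_conj_apply hρ hσ B w).integrable_of_compactSpace
  map_smul' c v := by
    simp only [map_smul, RingHom.id_apply]
    exact integral_smul c _
  isIntertwining' h := by
    ext v
    have e : σ h (∫ g, σ g (B (ρ g⁻¹ v)) ∂dg) = ∫ g, σ h (σ g (B (ρ g⁻¹ v))) ∂dg :=
      ((LinearMap.toContinuousLinearMap (σ h)).integral_comp_comm
        (continuous_conj_apply hρ hσ B v).integrable_of_compactSpace).symm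
    change ∫ g, σ g (B (ρ g⁻¹ (ρ h v))) ∂dg = σ h (∫ g, σ g (B (ρ g⁻¹ v)) ∂dg)
    -- Left invariance replaces `g` by `h * g`, and `ρ (h * g)⁻¹` absorbs `ρ h`.
    rw [e, ← integral_mul_left_eq_self (fun g => σ g (B (ρ g⁻¹ (ρ h v)))) h]
    refine integral_congr_ae (.of_forall fun g => ?_)
    simp [← Module.End.mul_apply, ← map_mul]

theorem average_apply {ρ : Representation ℂ G V} {σ : Representation ℂ G W}
    (hρ : ρ.ContinuousCoeff) (hσ : σ.ContinuousCoeff) (B : V →ₗ[ℂ] W) (v : V) :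
    average dg hρ hσ B v = ∫ g, σ g (B (ρ g⁻¹ v)) ∂dg := rfl

/-- The bridge from Schur's lemma to characters: averaging the rank-one map `b_i* ⊗ x` and
evaluating at `b_i` yields the diagonal coefficient of `ρ g⁻¹` as a weight, and these sum to the
trace. -/
theorem sum_average_smulRight {ρ : Representation ℂ G V} {σ : Representation ℂ G W}
    (hρ : ρ.ContinuousCoeff) (hσ : σ.ContinuousCoeff) {ι : Type*} [Fintype ι]
    (b : Module.Basis ι ℂ V) (x : W) :
    ∑ i, average dg hρ hσ ((b.coord i).smulRight x) (b i) =
      ∫ g, ρ.character g⁻¹ • σ g x ∂dg := by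
  simp only [average_apply]
  rw [← integral_finsetSum _ fun i _ => 
    (continuous_conj_apply hρ hσ ((b.coord i).smulRight x) (b i)).integrable_of_compactSpace]
  refine integral_congr_ae (.of_forall fun g => ?_)
  simp [ρ.character_eq_sum_coord b, Finset.sum_smul]

theorem integral_character_inv_smul_of_not_equiv [FiniteDimensional ℂ V]
    {ρ : Representation ℂ G V} {σ : Representation ℂ G W}
    (hρ : ρ.ContinuousCoeff) (hσ : σ.ContinuousCoeff) (hρi : ρ.IsIrreducible)
    (hσi : σ.IsIrreducible) (hne : ¬ Equivalent ρ σ) (x : W) :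
    ∫ g, ρ.character g⁻¹ • σ g x ∂dg = 0 := by
  have : IsEmpty (ρ.Equiv σ) := not_nonempty_iff.1 hne
  rw [← sum_average_smulRight dg hρ hσ (Module.finBasis ℂ V)]
  refine Finset.sum_eq_zero fun i _ => ?_
  rw [Subsingleton.elim (average dg hρ hσ _) 0]
  rfl

theorem trace_average [IsProbabilityMeasure dg] {σ : Representation ℂ G W} (hσ : σ.ContinuousCoeff) (B : W →ₗ[ℂ] W) :
    LinearMap.trace ℂ W (average dg hσ hσ B).toLinearMap = LinearMap.trace ℂ W B := by
  classical
  let b := Module.finBasis ℂ W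
  have h (A : W →ₗ[ℂ] W) : LinearMap.trace ℂ W A = ∑ i, b.coord i (A (b i)) := by
    rw [LinearMap.trace_eq_matrix_trace ℂ b, Matrix.trace]
    simp [LinearMap.toMatrix_apply]
  have hi (i) : b.coord i (∫ g, σ g (B (σ g⁻¹ (b i))) ∂dg) =
      ∫ g, b.coord i (σ g (B (σ g⁻¹ (b i)))) ∂dg :=
    ((LinearMap.toContinuousLinearMap (b.coord i)).integral_comp_comm
      (continuous_conj_apply hσ hσ B _).integrable_of_compactSpace).symm
  have hint (i) : Integrable (fun g => b.coord i (σ g (B (σ g⁻¹ (b i))))) dg :=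
    ((b.coord i).continuous_of_finiteDimensional.comp
      (continuous_conj_apply hσ hσ B (b i))).integrable_of_compactSpace
  rw [h]
  change ∑ i, b.coord i (∫ g, σ g (B (σ g⁻¹ (b i))) ∂dg) = _
  simp only [hi]
  rw [← integral_finsetSum _ fun i _ => hint i]
  have e (g : G) : ∑ i, b.coord i (σ g (B (σ g⁻¹ (b i)))) = LinearMap.trace ℂ W B := by
    have := h (σ g * B * σ g⁻¹)
    rw [LinearMap.trace_mul_comm, ← mul_assoc, ← map_mul, inv_mul_cancel, map_one, one_mul] at this
    rw [this]
    rfl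
  simp only [e]
  simp

/-- By Schur's lemma the average of `b_i* ⊗ x` is a scalar `c`. Averaging preserves the trace, so `c
* dim W = b_i*(x)`; summing over `i` reassembles `x`. -/
theorem finrank_smul_integral_character_inv_smul [IsProbabilityMeasure dg]
    {σ : Representation ℂ G W}
    (hσ : σ.ContinuousCoeff) (hσi : σ.IsIrreducible) (x : W) :
    (Module.finrank ℂ W : ℂ) • ∫ g, σ.character g⁻¹ • σ g x ∂dg = x := by
  let b := Module.finBasis ℂ W
  rw [← sum_average_smulRight dg hσ hσ b, Finset.smul_sum]
  have h (i) : (Module.finrank ℂ W : ℂ) • average dg hσ hσ ((b.coord i).smulRight x) (b i) =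
      b.coord i x • b i := by
    obtain ⟨c, hc⟩ := IsIrreducible.algebraMap_intertwiningMap_bijective_of_isAlgClosed.2
      (average dg hσ hσ ((b.coord i).smulRight x))
    have ht := trace_average dg hσ ((b.coord i).smulRight x)
    rw [LinearMap.trace_smulRight, ← hc] at ht
    have e : (algebraMap ℂ (σ.IntertwiningMap σ) c).toLinearMap = c • LinearMap.id := by
      ext; rfl
    rw [e, map_smul, LinearMap.trace_id] at ht
    rw [← ht, ← hc, IntertwiningMap.algebraMap_apply, IntertwiningMap.smul_apply,
      smul_smul, smul_eq_mul, mul_comm]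
    rfl
  simp only [h]
  simp

end Average

end Representation

namespace Representation

theorem _root_.KLProjection.Equivalent.symm {G V W : Type*} [Group G] [AddCommGroup V] [Module ℂ V] [AddCommGroup W] [Module ℂ W]
    {σ : Representation ℂ G V} {τ : Representation ℂ G W} :
    Equivalent σ τ → Equivalent τ σ := fun ⟨e⟩ => ⟨e.symm⟩

theorem _root_.KLProjection.Equivalent.trans {G V W U : Type*} [Group G] [AddCommGroup V] [Module ℂ V] [AddCommGroup W]
    [Module ℂ W] [AddCommGroup U] [Module ℂ U]
    {σ : Representation ℂ G V} {τ : Representation ℂ G W} {υ : Representation ℂ G U} :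
    Equivalent σ τ → Equivalent τ υ → Equivalent σ υ := fun ⟨e⟩ ⟨e'⟩ => ⟨e.trans e'⟩

/-! ### Character averages on isotypic components. -/

section WeightedAverage

variable {G V W U : Type*} [Group G] [TopologicalSpace G] [IsTopologicalGroup G] [CompactSpace G]
  [MeasurableSpace G] [BorelSpace G] [AddCommGroup V] [Module ℂ V]
  [NormedAddCommGroup W] [NormedSpace ℂ W] [FiniteDimensional ℂ W]
  [NormedAddCommGroup U] [NormedSpace ℂ U] [FiniteDimensional ℂ U]
  (dg : Measure G) [dg.IsHaarMeasure]

/-- The operator `x ↦ ∫ c(g) ρ(g) x dg`. -/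
noncomputable def weightedAverage {ρ : Representation ℂ G W} (hρ : ρ.ContinuousCoeff) {c : G → ℂ}
    (hc : Continuous c) : W →ₗ[ℂ] W where
  toFun x := ∫ g, c g • ρ g x ∂dg
  map_add' x y := by
    simp only [map_add, smul_add]
    exact integral_add (hc.smul (hρ.continuous x)).integrable_of_compactSpace
      (hc.smul (hρ.continuous y)).integrable_of_compactSpace
  map_smul' a x := by
    simp only [map_smul, RingHom.id_apply, smul_comm _ a]
    exact integral_smul a _

omit [IsTopologicalGroup G] in
theorem weightedAverage_apply {ρ : Representation ℂ G W} (hρ : ρ.ContinuousCoeff) {c : G → ℂ}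
    (hc : Continuous c) (x : W) : weightedAverage dg hρ hc x = ∫ g, c g • ρ g x ∂dg := rfl

omit [IsTopologicalGroup G] in
theorem weightedAverage_intertwining {ρ : Representation ℂ G W} {τ : Representation ℂ G U}
    (hρ : ρ.ContinuousCoeff) (hτ : τ.ContinuousCoeff) {c : G → ℂ} (hc : Continuous c)
    (j : U →ₗ[ℂ] W) (hj : ∀ g u, j (τ g u) = ρ g (j u)) (u : U) :
    weightedAverage dg hρ hc (j u) = j (weightedAverage dg hτ hc u) := by
  have := (LinearMap.toContinuousLinearMap j).integral_comp_comm
    ((hc.smul (hτ.continuous u)).integrable_of_compactSpace (μ := dg))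
  simp only [weightedAverage_apply, ← hj]
  rw [← LinearMap.coe_toContinuousLinearMap' j]
  simpa using this

/-- Two linear maps agree on an isotypic component if they agree on the images of all embeddings
of its type. -/
theorem eqOn_isotypic {G V W Z : Type*} [Group G] [AddCommGroup V] [Module ℂ V] [AddCommGroup W]
    [Module ℂ W] [AddCommGroup Z] [Module ℂ Z] {ρ : Representation ℂ G V}
    {τ : Representation ℂ G W} {A B : V →ₗ[ℂ] Z}
    (h : ∀ j : W →ₗ[ℂ] V, (∀ g w, j (τ g w) = ρ g (j w)) → ∀ w, A (j w) = B (j w))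
    {x : V} (hx : x ∈ isotypic ρ τ) : A x = B x := by
  suffices isotypic ρ τ ≤ LinearMap.eqLocus A B from this hx
  refine sSup_le ?_
  rintro _ ⟨S, rfl, ⟨e⟩⟩ v hv
  have := h (S.toSubmodule.subtype ∘ₗ e.symm.toLinearEquiv.toLinearMap) (fun g w => by
    change ((e.symm (τ g w) : S.toSubmodule) : V) = ρ g (e.symm w : S.toSubmodule)
    rw [e.symm.apply_rep]
    rfl) (e ⟨v, hv⟩)
  have e1 : (S.toSubmodule.subtype ∘ₗ e.symm.toLinearEquiv.toLinearMap) (e ⟨v, hv⟩) = v := by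
    change ((e.symm (e ⟨v, hv⟩) : S.toSubmodule) : V) = v
    rw [e.symm_apply_apply]
  rw [e1] at this
  exact this

variable [FiniteDimensional ℂ V] {ρ : Representation ℂ G W} {τ : Representation ℂ G U}
  {π : Representation ℂ G V}

omit [CompactSpace G] [MeasurableSpace G] [BorelSpace G] in
theorem ContinuousCoeff.character_inv (hπ : π.ContinuousCoeff) :
    Continuous fun g => π.character g⁻¹ := hπ.character.comp continuous_inv

/-- An intertwining map from `τ` carries the average over `τ` to the average over `ρ`, so Schur
orthogonality on `τ` decides. The same reduction gives the equivalent case below. -/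
theorem weightedAverage_eq_zero_of_mem_isotypic (hρ : ρ.ContinuousCoeff)
    (hτ : τ.ContinuousCoeff) (hπ : π.ContinuousCoeff) (hτi : τ.IsIrreducible)
    (hπi : π.IsIrreducible) (hne : ¬ Equivalent π τ) {x : W} (hx : x ∈ isotypic ρ τ) :
    weightedAverage dg hρ hπ.character_inv x = 0 := by
  refine eqOn_isotypic (B := 0) (fun j hj u => ?_) hx
  rw [weightedAverage_intertwining dg hρ hτ hπ.character_inv j hj, weightedAverage_apply,
    integral_character_inv_smul_of_not_equiv dg hπ hτ hπi hτi hne, map_zero]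
  rfl

theorem smul_weightedAverage_of_mem_isotypic [IsProbabilityMeasure dg] (hρ : ρ.ContinuousCoeff)
    (hτ : τ.ContinuousCoeff) (hπ : π.ContinuousCoeff) (hτi : τ.IsIrreducible)
    (he : Equivalent π τ) {x : W} (hx : x ∈ isotypic ρ τ) :
    (Module.finrank ℂ V : ℂ) • weightedAverage dg hρ hπ.character_inv x = x := by
  obtain ⟨e⟩ := he
  refine eqOn_isotypic (A := (Module.finrank ℂ V : ℂ) • weightedAverage dg hρ hπ.character_inv)
    (B := LinearMap.id) (fun j hj u => ?_) hx
  rw [LinearMap.smul_apply, weightedAverage_intertwining dg hρ hτ hπ.character_inv j hj,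
    weightedAverage_apply, ← map_smul, char_iso e, e.toLinearEquiv.finrank_eq,
    finrank_smul_integral_character_inv_smul dg hτ hτi]
  rfl

/-- Irreducible representations of a compact group with equal characters are equivalent. -/
theorem equivalent_of_character_eq [IsProbabilityMeasure dg] (hπ : π.ContinuousCoeff)
    (hτ : τ.ContinuousCoeff) (hπi : π.IsIrreducible) (hτi : τ.IsIrreducible)
    (h : ∀ g, π.character g = τ.character g) : Equivalent π τ := by
  -- If they were inequivalent, the same character integral would be both zero and a multiple of it
  -- equal to `x ≠ 0`.
  by_contra hne
  have : Nontrivial U := ((isIrreducible_iff_submodule τ).1 hτi).1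
  obtain ⟨x, hx⟩ := exists_ne (0 : U)
  apply hx
  rw [← finrank_smul_integral_character_inv_smul dg hτ hτi x]
  simp only [← h]
  rw [integral_character_inv_smul_of_not_equiv dg hπ hτ hπi hτi hne, smul_zero]

end WeightedAverage

/-! ### Orthogonality of isotypic components and the canonical decomposition. -/

section Unitary

variable {G E : Type*} [Group G] [NormedAddCommGroup E] [InnerProductSpace ℂ E]
  [FiniteDimensional ℂ E] {ρ : Representation ℂ G E}

omit [FiniteDimensional ℂ E] in
theorem inner_apply_apply_of_norm (hρ : ∀ g v, ‖ρ g v‖ = ‖v‖) (g : G) (v w : E) :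
    inner ℂ (ρ g v) (ρ g w) = inner ℂ v w :=
  LinearIsometry.inner_map_map ⟨ρ g, hρ g⟩ v w

omit [FiniteDimensional ℂ E] in
theorem inner_apply_left_of_norm (hρ : ∀ g v, ‖ρ g v‖ = ‖v‖) (g : G) (v w : E) :
    inner ℂ (ρ g v) w = inner ℂ v (ρ g⁻¹ w) := by
  have h : ρ g (ρ g⁻¹ w) = w := by rw [← Module.End.mul_apply, ← map_mul]; simp
  rw [← inner_apply_apply_of_norm hρ g v, h]

omit [FiniteDimensional ℂ E] in
theorem orthogonal_stable (hρ : ∀ g v, ‖ρ g v‖ = ‖v‖) {U : Submodule ℂ E}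
    (hU : ∀ g, ∀ v ∈ U, ρ g v ∈ U) (g : G) (v : E) (hv : v ∈ Uᗮ) : ρ g v ∈ Uᗮ := by
  rw [Submodule.mem_orthogonal'] at hv ⊢
  intro u hu
  rw [inner_apply_left_of_norm hρ]
  exact hv _ (hU _ _ hu)

theorem orthogonalProjectionOnto_apply_rep (hρ : ∀ g v, ‖ρ g v‖ = ‖v‖) (S : Subrepresentation ρ)
    (g : G) (v : E) :
    S.toSubmodule.orthogonalProjectionOnto (ρ g v) =
      S.toRepresentation g (S.toSubmodule.orthogonalProjectionOnto v) := by
  refine Subtype.ext <| Submodule.eq_starProjection_of_mem_orthogonal (u := ρ g v)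
    (v := ρ g (S.toSubmodule.orthogonalProjectionOnto v))
    (S.apply_mem_toSubmodule g (Subtype.coe_prop _)) ?_
  rw [← map_sub]
  exact orthogonal_stable hρ (fun g v hv => S.apply_mem_toSubmodule g hv) g _
    (Submodule.sub_starProjection_mem_orthogonal v)

/-- The orthogonal projection from a copy of `σ` to a copy of `τ` is an intertwining map, hence zero
by Schur's lemma. -/
theorem isotypic_isOrtho {V W : Type*} [AddCommGroup V] [Module ℂ V] [AddCommGroup W] [Module ℂ W]
    (hρ : ∀ g v, ‖ρ g v‖ = ‖v‖) {σ : Representation ℂ G V} {τ : Representation ℂ G W}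
    (hσ : σ.IsIrreducible) (hτ : τ.IsIrreducible) (hne : ¬ Equivalent σ τ) :
    isotypic ρ σ ⟂ isotypic ρ τ := by
  have : IsEmpty (σ.Equiv τ) := not_nonempty_iff.1 hne
  rw [isotypic, isotypic, Submodule.isOrtho_sSup_left]
  rintro _ ⟨S, rfl, ⟨e⟩⟩
  rw [Submodule.isOrtho_sSup_right]
  rintro _ ⟨S', rfl, ⟨e'⟩⟩
  rw [Submodule.isOrtho_iff_inner_eq]
  intro u hu v hv
  let A : σ.IntertwiningMap τ :=
    { toLinearMap := e'.toLinearEquiv.toLinearMap ∘ₗ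
        S'.toSubmodule.orthogonalProjectionOnto.toLinearMap ∘ₗ S.toSubmodule.subtype ∘ₗ
        e.symm.toLinearEquiv.toLinearMap
      isIntertwining' := fun g => by
        ext w
        change e' (S'.toSubmodule.orthogonalProjectionOnto (e.symm (σ g w) : S.toSubmodule)) =
          τ g (e' (S'.toSubmodule.orthogonalProjectionOnto (e.symm w : S.toSubmodule)))
        rw [e.symm.apply_rep, ← e'.apply_rep, ← orthogonalProjectionOnto_apply_rep hρ]
        rfl }
  have hA : e' (S'.toSubmodule.orthogonalProjectionOnto (e.symm (e ⟨u, hu⟩) : S.toSubmodule)) = 0 :=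
    congrArg (fun B : σ.IntertwiningMap τ => B (e ⟨u, hu⟩)) (Subsingleton.elim A 0)
  rw [e.symm_apply_apply] at hA
  have h0 : S'.toSubmodule.orthogonalProjectionOnto u = 0 :=
    e'.toLinearEquiv.injective (hA.trans (map_zero e'.toLinearEquiv).symm)
  rw [Submodule.orthogonalProjectionOnto_eq_zero_iff] at h0
  exact (Submodule.mem_orthogonal' _ _).1 h0 v hv

/-- A minimal nonzero stable subspace of `U` is irreducible; finite dimension provides one. -/
theorem exists_irreducible_le {U : Submodule ℂ E} (hU : ∀ g, ∀ v ∈ U, ρ g v ∈ U) (h0 : U ≠ ⊥) :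
    ∃ S : Subrepresentation ρ, S.toSubmodule ≤ U ∧ S.toRepresentation.IsIrreducible := by
  obtain ⟨M, ⟨hM, hM0, hMU⟩, hmin⟩ := WellFounded.has_min
    (wellFounded_lt (α := Submodule ℂ E))
    {M | (∀ g, ∀ v ∈ M, ρ g v ∈ M) ∧ M ≠ ⊥ ∧ M ≤ U} ⟨U, hU, h0, le_rfl⟩
  refine ⟨⟨M, fun g v hv => hM g v hv⟩, hMU, ?_⟩
  rw [isIrreducible_iff_submodule]
  refine ⟨Submodule.nontrivial_iff_ne_bot.2 hM0, fun N hN => ?_⟩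
  by_cases hN0 : N = ⊥
  · exact .inl hN0
  right
  have hle : N.map M.subtype ≤ M := Submodule.map_subtype_le M N
  have h1 : N.map M.subtype = M := by
    by_contra hne
    refine hmin (N.map M.subtype) ⟨?_, ?_, hle.trans hMU⟩ (lt_of_le_of_ne hle hne)
    · rintro g _ ⟨v, hv, rfl⟩
      exact ⟨_, hN g v hv, rfl⟩
    · rwa [Ne, ← Submodule.map_bot M.subtype,
        (Submodule.map_injective_of_injective M.injective_subtype).eq_iff]
  apply Submodule.map_injective_of_injective M.injective_subtype
  rw [h1, Submodule.map_subtype_top]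

omit [FiniteDimensional ℂ E] in
theorem isotypic_congr {V W : Type*} [AddCommGroup V] [Module ℂ V] [AddCommGroup W] [Module ℂ W]
    {σ : Representation ℂ G V} {τ : Representation ℂ G W} (h : Equivalent σ τ) :
    isotypic ρ σ = isotypic ρ τ := by
  unfold isotypic
  congr 1
  ext U
  exact ⟨fun ⟨S, hS, hSU⟩ => ⟨S, hS, hSU.trans h⟩, fun ⟨S, hS, hSU⟩ => ⟨S, hS, hSU.trans h.symm⟩⟩

omit [FiniteDimensional ℂ E] in
variable (ρ) in
theorem isotypic_stable {V : Type*} [AddCommGroup V] [Module ℂ V] (σ : Representation ℂ G V)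
    (g : G) (v : E) (hv : v ∈ isotypic ρ σ) : ρ g v ∈ isotypic ρ σ := by
  suffices isotypic ρ σ ≤ (isotypic ρ σ).comap (ρ g) from this hv
  refine sSup_le ?_
  rintro _ ⟨S, rfl, e⟩ v hv
  have hle : S.toSubmodule ≤ isotypic ρ σ := le_sSup ⟨S, rfl, e⟩
  exact hle (S.apply_mem_toSubmodule g hv)

variable [TopologicalSpace G]

/-- An irreducible unitary representation is equivalent to one on a standard space `ℂᵈ`. -/
theorem exists_unitaryIrrep_equivalent
    (hc : Continuous fun p : G × E => ρ p.1 p.2) (hρ : ∀ g v, ‖ρ g v‖ = ‖v‖)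
    (hi : ρ.IsIrreducible) : ∃ π : UnitaryIrrep G, Equivalent ρ π.rep := by
  let b := (stdOrthonormalBasis ℂ E).repr
  let σ : Representation ℂ G (EuclideanSpace ℂ (Fin (Module.finrank ℂ E))) :=
    { toFun := fun g => b.toLinearEquiv.conj (ρ g)
      map_one' := by rw [map_one]; exact LinearEquiv.conj_id _
      map_mul' := fun g h => by rw [map_mul]; exact LinearEquiv.conj_comp _ _ _ }
  have hσ (g v) : σ g v = b (ρ g (b.symm v)) := rfl
  let e : ρ.Equiv σ := Equiv.mk b.toLinearEquiv fun g => by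
    ext1 v
    change b (ρ g v) = σ g (b v)
    rw [hσ, b.symm_apply_apply]
  refine ⟨⟨_, σ, ?_, fun g v => ?_, hi.of_equiv e⟩, ⟨e⟩⟩
  · simp only [hσ]
    exact b.continuous.comp (hc.comp (continuous_fst.prodMk (b.symm.continuous.comp continuous_snd)))
  · rw [hσ, b.norm_map, hρ, b.symm.norm_map]

theorem exists_isCanonicalDecomposition
    (hc : Continuous fun p : G × E => ρ p.1 p.2) (hρ : ∀ g v, ‖ρ g v‖ = ‖v‖) :
    ∃ (h : ℕ) (τ : Fin h → UnitaryIrrep G), IsCanonicalDecomposition ρ τ := by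
  let s : Setoid (UnitaryIrrep G) :=
    { r := fun π σ => Equivalent π.rep σ.rep
      iseqv := ⟨fun π => ⟨.refl π.rep⟩, Equivalent.symm, Equivalent.trans⟩ }
  -- One representative per class that occurs. Nonzero independent subspaces of a finite-dimensional
  -- space are finite in number, so this type can be enumerated by some `Fin h`.
  let I := {c : Quotient s // isotypic ρ c.out.rep ≠ ⊥}
  have hne (c d : Quotient s) (hcd : c ≠ d) : ¬ Equivalent c.out.rep d.out.rep := fun h =>
    hcd (by rw [← c.out_eq, ← d.out_eq]; exact Quotient.sound h)
  have hpair (c d : I) (hcd : c ≠ d) :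
      isotypic ρ c.1.out.rep ⟂ isotypic ρ d.1.out.rep :=
    isotypic_isOrtho hρ c.1.out.irreducible_rep d.1.out.irreducible_rep
      (hne _ _ fun h => hcd (Subtype.ext h))
  have hort : OrthogonalFamily ℂ (fun c : I => isotypic ρ c.1.out.rep)
      fun c => (isotypic ρ c.1.out.rep).subtypeₗᵢ := OrthogonalFamily.of_pairwise hpair
  have hfin : Finite I := WellFoundedGT.finite_of_iSupIndep hort.independent fun c => c.2
  obtain ⟨h, ⟨e⟩⟩ := Finite.exists_equiv_fin I
  refine ⟨h, fun i => (e.symm i).1.out, ?_, fun l => (e.symm l).2, ?_⟩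
  · exact fun k l hkl => hne _ _ fun h => hkl (e.symm.injective (Subtype.ext h))
  · have hort' : OrthogonalFamily ℂ (fun i => isotypic ρ (e.symm i).1.out.rep)
        fun i => (isotypic ρ (e.symm i).1.out.rep).subtypeₗᵢ := hort.comp e.symm.injective
    rw [hort'.isInternal_iff]
    -- Otherwise the complement of the sum contains an irreducible `S`. It also lies in the
    -- component of its own type, so it is orthogonal to itself.
    by_contra hbot
    obtain ⟨S, hS, hSi⟩ := exists_irreducible_le
      (orthogonal_stable hρ fun g v hv => by
        suffices (⨆ i, isotypic ρ (e.symm i).1.out.rep) ≤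
          (⨆ i, isotypic ρ (e.symm i).1.out.rep).comap (ρ g) from this hv
        exact iSup_le fun i v hv => Submodule.mem_iSup_of_mem i
          (isotypic_stable ρ _ g v hv)) hbot
    obtain ⟨π, hπ⟩ := exists_unitaryIrrep_equivalent (ρ := S.toRepresentation)
      (Continuous.subtype_mk (hc.comp (continuous_fst.prodMk
        (continuous_subtype_val.comp continuous_snd))) _) (fun g v => hρ g v) hSi
    have hS' : S.toSubmodule ≤ isotypic ρ (Quotient.mk s π).out.rep := by
      rw [isotypic_congr (Quotient.mk_out (s := s) π)]
      exact le_sSup ⟨S, rfl, hπ⟩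
    have hS0 : S.toSubmodule ≠ ⊥ := Submodule.nontrivial_iff_ne_bot.1
      ((isIrreducible_iff_submodule _).1 hSi).1
    let c : I := ⟨Quotient.mk s π, fun h => hS0 (le_bot_iff.1 (h ▸ hS'))⟩
    have hle : S.toSubmodule ≤ ⨆ i, isotypic ρ (e.symm i).1.out.rep := by
      refine le_trans ?_ (le_iSup (fun i => isotypic ρ (e.symm i).1.out.rep) (e c))
      rw [e.symm_apply_apply]
      exact hS'
    exact hS0 (Submodule.isOrtho_self.1 (hle.trans (Submodule.le_orthogonal_iff_le_orthogonal.1 hS)))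

end Unitary

end Representation

namespace KLProjection

/-! ### The `L²` bound for `f ↦ f^π`. -/

section L2

variable {G T : Type*} [Group G] [TopologicalSpace G] [IsTopologicalGroup G] [CompactSpace G]
  [MeasurableSpace G] [BorelSpace G]
  (dg : Measure G) [IsProbabilityMeasure dg]
  [MeasurableSpace T] [MulAction G T]
  (m : Measure T)

theorem UnitaryIrrep.continuousCoeff {G : Type*} [Group G] [TopologicalSpace G]
    (π : UnitaryIrrep G) : π.rep.ContinuousCoeff :=
  Representation.continuousCoeff_of_continuous fun _ =>
    π.continuous_rep.comp (continuous_id.prodMk continuous_const)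

variable [MeasurableSMul₂ G T]

omit [CompactSpace G] [IsProbabilityMeasure dg] in
theorem measurable_inv_smul_prod : Measurable fun p : T × G => p.2⁻¹ • p.1 := by fun_prop

variable [SigmaFinite m] [SMulInvariantMeasure G T m]

-- Because of this, changing `f` on an `m`-null set changes `g ↦ f (g⁻¹ • t)` only on a null set,
-- for almost every `t`.
omit [CompactSpace G] in
theorem quasiMeasurePreserving_inv_smul :
    Measure.QuasiMeasurePreserving (fun p : T × G => p.2⁻¹ • p.1) (m.prod dg) m :=
  QuasiMeasurePreserving.prod_of_left measurable_inv_smul_prod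
    (.of_forall fun g => (measurePreserving_smul g⁻¹ m).quasiMeasurePreserving)

variable {m}

omit [CompactSpace G] in
theorem ae_ae_eq_inv_smul {f f' : T → ℂ} (h : f =ᵐ[m] f') :
    ∀ᵐ t ∂m, ∀ᵐ g ∂dg, f (g⁻¹ • t) = f' (g⁻¹ • t) :=
  Measure.ae_ae_of_ae_prod ((quasiMeasurePreserving_inv_smul dg m).ae h)

omit [CompactSpace G] in
theorem aestronglyMeasurable_inv_smul {f : T → ℂ} (hf : AEStronglyMeasurable f m) :
    AEStronglyMeasurable (fun p : T × G => f (p.2⁻¹ • p.1)) (m.prod dg) :=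
  hf.comp_quasiMeasurePreserving (quasiMeasurePreserving_inv_smul dg m)

theorem eLpNorm_two_sq {α : Type*} [MeasurableSpace α] (μ : Measure α) (F : α → ℂ) :
    eLpNorm F 2 μ ^ 2 = ∫⁻ a, ‖F a‖ₑ ^ 2 ∂μ := by
  have := eLpNorm_nnreal_pow_eq_lintegral (f := F) (μ := μ) (p := 2) (by norm_num)
  simpa using this

omit [CompactSpace G] in
theorem lintegral_eLpNorm_inv_smul {f : T → ℂ} (hf : AEStronglyMeasurable f m) :
    ∫⁻ t, eLpNorm (fun g : G => f (g⁻¹ • t)) 2 dg ^ 2 ∂m = eLpNorm f 2 m ^ 2 := by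
  simp only [eLpNorm_two_sq]
  calc ∫⁻ t, ∫⁻ g, ‖f ((g : G)⁻¹ • t)‖ₑ ^ 2 ∂dg ∂m
      = ∫⁻ g, ∫⁻ t, ‖f ((g : G)⁻¹ • t)‖ₑ ^ 2 ∂m ∂dg :=
        lintegral_lintegral_swap ((aestronglyMeasurable_inv_smul dg hf).enorm.pow_const 2)
    _ = ∫⁻ _ : G, ∫⁻ t, ‖f t‖ₑ ^ 2 ∂m ∂dg := by
        refine lintegral_congr fun g => ?_
        exact ((measurePreserving_smul g⁻¹ m).lintegral_comp_emb
          (measurableEmbedding_const_smul g⁻¹) (fun t => ‖f t‖ₑ ^ 2))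
    _ = ∫⁻ t, ‖f t‖ₑ ^ 2 ∂m := by simp

omit [CompactSpace G] in
theorem ae_memLp_inv_smul {f : T → ℂ} (hf : MemLp f 2 m) :
    ∀ᵐ t ∂m, MemLp (fun g : G => f (g⁻¹ • t)) 2 dg := by
  have hm : AEMeasurable (fun t => eLpNorm (fun g : G => f (g⁻¹ • t)) 2 dg ^ 2) m := by
    simp only [eLpNorm_two_sq]
    exact ((aestronglyMeasurable_inv_smul dg hf.1).enorm.pow_const 2).lintegral_prod_right'
  have hfin : ∀ᵐ t ∂m, eLpNorm (fun g : G => f (g⁻¹ • t)) 2 dg ^ 2 < ∞ := by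
    refine ae_lt_top' hm ?_
    rw [lintegral_eLpNorm_inv_smul dg hf.1]
    exact ENNReal.pow_ne_top hf.2.ne
  filter_upwards [hfin, (aestronglyMeasurable_inv_smul dg hf.1).prodMk_left] with t h1 h2
  exact ⟨h2, by simpa using h1⟩

theorem ae_integrable_mul_inv_smul {c : G → ℂ} (hc : Continuous c) {f : T → ℂ}
    (hf : MemLp f 2 m) : ∀ᵐ t ∂m, Integrable (fun g : G => c g * f (g⁻¹ • t)) dg := by
  obtain ⟨C, hC⟩ := (isCompact_range hc).isBounded.exists_norm_le
  filter_upwards [ae_memLp_inv_smul dg hf] with t ht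
  exact (ht.integrable one_le_two).bdd_mul hc.measurable.aestronglyMeasurable
    (.of_forall fun g => hC _ ⟨g, rfl⟩)

/-- The bound `D = d_π C`, with `C` a bound for `|χ_π|`, is independent of `f`, so it also controls
`F N - f` in the limit argument. The `L¹(dg)` norm of the orbit function is at most its `L²(dg)`
norm because `dg` has mass one. -/
theorem exists_eLpNorm_charProj_le (π : UnitaryIrrep G) : ∃ D : ℝ≥0∞, D ≠ ∞ ∧
    ∀ f : T → ℂ, AEStronglyMeasurable f m →
      AEStronglyMeasurable (charProj dg π f) m ∧
      eLpNorm (charProj dg π f) 2 m ≤ D * eLpNorm f 2 m := by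
  have hc := π.continuousCoeff.character
  obtain ⟨C, hC⟩ := (isCompact_range hc).isBounded.exists_norm_le
  refine ⟨‖(π.dim : ℂ)‖ₑ * ENNReal.ofReal C, by finiteness, fun f hf => ⟨?_, ?_⟩⟩
  · refine AEStronglyMeasurable.const_mul (AEStronglyMeasurable.integral_prod_right' (ν := dg)
      (f := fun p : T × G => π.rep.character p.2 * f (p.2⁻¹ • p.1)) ?_) _
    exact (hc.measurable.comp measurable_snd).aestronglyMeasurable.mul
      (aestronglyMeasurable_inv_smul dg hf)
  have hpt : ∀ᵐ t ∂m, ‖charProj dg π f t‖ₑ ≤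
      ‖(π.dim : ℂ)‖ₑ * ENNReal.ofReal C * eLpNorm (fun g : G => f (g⁻¹ • t)) 2 dg := by
    filter_upwards [(aestronglyMeasurable_inv_smul dg hf).prodMk_left] with t ht
    rw [charProj, enorm_mul, mul_assoc]
    gcongr
    calc ‖∫ g, π.rep.character g * f (g⁻¹ • t) ∂dg‖ₑ
        ≤ ∫⁻ g, ‖π.rep.character g * f (g⁻¹ • t)‖ₑ ∂dg := enorm_integral_le_lintegral_enorm _
      _ ≤ ∫⁻ g, ENNReal.ofReal C * ‖f (g⁻¹ • t)‖ₑ ∂dg := by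
          refine lintegral_mono fun g => ?_
          rw [enorm_mul]
          gcongr
          rw [← ofReal_norm]
          exact ENNReal.ofReal_le_ofReal (hC _ ⟨g, rfl⟩)
      _ = ENNReal.ofReal C * eLpNorm (fun g : G => f (g⁻¹ • t)) 1 dg := by
          rw [lintegral_const_mul' _ _ ENNReal.ofReal_ne_top, eLpNorm_one_eq_lintegral_enorm]
      _ ≤ _ := by
          gcongr
          exact eLpNorm_le_eLpNorm_of_exponent_le one_le_two ht
  rw [← ENNReal.pow_le_pow_left_iff two_ne_zero, mul_pow, ← lintegral_eLpNorm_inv_smul dg hf,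
    ← lintegral_const_mul' _ _ (by finiteness)]
  rw [eLpNorm_two_sq m (charProj dg π f)]
  refine lintegral_mono_ae ?_
  filter_upwards [hpt] with t ht
  rw [← mul_pow]
  gcongr

theorem memLp_charProj (π : UnitaryIrrep G) {f : T → ℂ} (hf : MemLp f 2 m) :
    MemLp (charProj dg π f) 2 m := by
  obtain ⟨D, hD, h⟩ := exists_eLpNorm_charProj_le dg (m := m) π
  exact ⟨(h f hf.1).1, (h f hf.1).2.trans_lt (ENNReal.mul_lt_top hD.lt_top hf.2)⟩

theorem charProj_sub_ae (π : UnitaryIrrep G) {f f' : T → ℂ} (hf : MemLp f 2 m)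
    (hf' : MemLp f' 2 m) :
    charProj dg π (fun t => f t - f' t) =ᵐ[m] fun t => charProj dg π f t - charProj dg π f' t := by
  have hc := π.continuousCoeff.character
  filter_upwards [ae_integrable_mul_inv_smul dg hc hf, ae_integrable_mul_inv_smul dg hc hf']
    with t h1 h2
  simp only [charProj, mul_sub]
  rw [integral_sub h1 h2, mul_sub]

theorem tendsto_eLpNorm_charProj_sub (π : UnitaryIrrep G) {F : ℕ → T → ℂ} {f : T → ℂ}
    (hF : ∀ N, MemLp (F N) 2 m) (hf : MemLp f 2 m)
    (h : Tendsto (fun N => eLpNorm (fun t => F N t - f t) 2 m) atTop (𝓝 0)) :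
    Tendsto (fun N => eLpNorm (fun t => charProj dg π (F N) t - charProj dg π f t) 2 m)
      atTop (𝓝 0) := by
  obtain ⟨D, hD, hle⟩ := exists_eLpNorm_charProj_le dg (m := m) π
  have h0 := ENNReal.Tendsto.const_mul h (.inr hD)
  rw [mul_zero] at h0
  refine tendsto_of_tendsto_of_tendsto_of_le_of_le tendsto_const_nhds h0 (fun _ => zero_le)
    fun N => ?_
  dsimp only
  rw [← eLpNorm_congr_ae (charProj_sub_ae dg π (hF N) hf)]
  exact (hle _ ((hF N).sub hf).1).2

end L2

end KLProjection

namespace Representation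

/-! ### Measurable isometric representations are continuous. -/

section Continuity

variable {G E : Type*} [Group G] [TopologicalSpace G] [IsTopologicalGroup G] [CompactSpace G]
  [T2Space G] [SecondCountableTopology G]
  [MeasurableSpace G] [BorelSpace G] (dg : Measure G) [dg.IsHaarMeasure]
  [NormedAddCommGroup E] [NormedSpace ℂ E] {ρ : Representation ℂ G E}

include dg in
/-- An isometric representation with strongly measurable orbit maps is strongly continuous. -/
theorem continuous_apply_of_stronglyMeasurable [IsProbabilityMeasure dg]
    (hρ : ∀ g v, ‖ρ g v‖ = ‖v‖)
    (hm : ∀ v, StronglyMeasurable fun g => ρ g v) (v : E) : Continuous fun g => ρ g v := by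
  have hF (w : E) : MemLp (fun g => ρ g⁻¹ w) 2 dg :=
    MemLp.of_bound ((hm w).comp_measurable measurable_inv).aestronglyMeasurable ‖w‖
      (.of_forall fun g => (hρ _ _).le)
  have : TopologicalSpace.MetrizableSpace G := TopologicalSpace.metrizableSpace_of_t3_secondCountable G
  have : Fact ((2 : ℝ≥0∞) ≠ ∞) := ⟨ENNReal.ofNat_ne_top⟩
  -- This embedding into `L²(G; E)` turns `g ↦ ρ g⁻¹ v` into an orbit of translation on `L²`, which
  -- is strongly continuous: the translate by `g` takes `h` to `ρ (g * h)⁻¹ v = ρ h⁻¹ (ρ g⁻¹ v)`.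
  have hiso : Isometry fun w => (hF w).toLp _ := by
    refine Isometry.of_dist_eq fun w w' => ?_
    rw [dist_eq_norm, dist_eq_norm, ← MemLp.toLp_sub, Lp.norm_toLp]
    have e : eLpNorm ((fun g => ρ g⁻¹ w) - fun g => ρ g⁻¹ w') 2 dg =
        eLpNorm (fun _ : G => w - w') 2 dg := by
      refine eLpNorm_congr_norm_ae (.of_forall fun g => ?_)
      rw [Pi.sub_apply, ← map_sub, hρ]
    rw [e, eLpNorm_const _ two_ne_zero (IsProbabilityMeasure.ne_zero dg)]
    simp
  have h : Continuous fun g : G => ρ g⁻¹ v := by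
    rw [hiso.isEmbedding.continuous_iff]
    have hc : Continuous fun g : G => DomMulAct.mk g • (hF v).toLp _ :=
      DomMulAct.continuous_mk.smul continuous_const
    convert hc using 2 with g
    rw [DomMulAct.mk_smul_toLp]
    refine MemLp.toLp_congr (hF (ρ g⁻¹ v)) _ (.of_forall fun h => ?_)
    simp [← Module.End.mul_apply, ← map_mul]
  simpa [Function.comp_def] using h.comp continuous_inv

omit [IsTopologicalGroup G] [CompactSpace G] [T2Space G] [SecondCountableTopology G]
  [MeasurableSpace G] [BorelSpace G] in
theorem continuous_uncurry_of_norm (hρ : ∀ g v, ‖ρ g v‖ = ‖v‖)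
    (hc : ∀ v, Continuous fun g => ρ g v) : Continuous fun p : G × E => ρ p.1 p.2 := by
  rw [continuous_iff_continuousAt]
  rintro ⟨g, v⟩
  rw [ContinuousAt, tendsto_iff_norm_sub_tendsto_zero]
  have h1 : Tendsto (fun p : G × E => ‖p.2 - v‖ + ‖ρ p.1 v - ρ g v‖) (𝓝 (g, v)) (𝓝 0) := by
    have : Continuous fun p : G × E => ‖p.2 - v‖ + ‖ρ p.1 v - ρ g v‖ :=
      (continuous_snd.sub continuous_const).norm.add
        (((hc v).comp continuous_fst).sub continuous_const).norm
    simpa using this.tendsto (g, v)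
  refine squeeze_zero (fun _ => norm_nonneg _) (fun p => ?_) h1
  calc ‖ρ p.1 p.2 - ρ g v‖ = ‖ρ p.1 (p.2 - v) + (ρ p.1 v - ρ g v)‖ := by rw [map_sub]; abel_nf
    _ ≤ _ := (norm_add_le _ _).trans (by rw [hρ])

end Continuity

end Representation

namespace KLProjection

/-! ### Translations on `L²(m)` and on the eigenspaces. -/

section Translation

variable {G T : Type*} [Group G] [MeasurableSpace T] [MulAction G T] {m : Measure T}

section Const

variable [MeasurableConstSMul G T] [SMulInvariantMeasure G T m]

theorem coeFn_translation (g : G) (f : Lp ℂ 2 m) :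
    translation m g f =ᵐ[m] fun t => f (g⁻¹ • t) :=
  Lp.coeFn_compMeasurePreserving f (measurePreserving_smul g⁻¹ m)

theorem norm_translation (g : G) (f : Lp ℂ 2 m) : ‖translation m g f‖ = ‖f‖ :=
  Lp.norm_compMeasurePreserving f (measurePreserving_smul g⁻¹ m)

/-- Writing `K t s` as `K (g⁻¹ • t) (g⁻¹ • s)` and substituting in `s` reduces the eigenvalue
equation at `t` to the one at `g⁻¹ • t`. -/
theorem translation_mem_kernelEigenspace {K : T → T → ℝ}
    (hK : ∀ (g : G) s t, K (g • s) (g • t) = K s t) (r : ℝ) (g : G) {f : Lp ℂ 2 m}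
    (hf : f ∈ kernelEigenspace m K r) : translation m g f ∈ kernelEigenspace m K r := by
  have hf' : ∀ᵐ t ∂m, Integrable (fun s => (K t s : ℂ) * f s) m ∧
    ∫ s, (K t s : ℂ) * f s ∂m = (r : ℂ) * f t := hf
  change ∀ᵐ t ∂m, Integrable (fun s => (K t s : ℂ) * translation m g f s) m ∧
    ∫ s, (K t s : ℂ) * translation m g f s ∂m = (r : ℂ) * translation m g f t
  have hmp := measurePreserving_smul g⁻¹ m
  filter_upwards [hmp.quasiMeasurePreserving.ae hf', coeFn_translation g f] with t ⟨h1, h2⟩ h3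
  have e : (fun s => (K t s : ℂ) * translation m g f s) =ᵐ[m]
      (fun s => (K (g⁻¹ • t) s : ℂ) * f s) ∘ fun s => g⁻¹ • s := by
    filter_upwards [coeFn_translation g f] with s hs
    rw [hs, Function.comp_apply, hK]
  refine ⟨(integrable_congr e).2 ((hmp.integrable_comp_emb
    (measurableEmbedding_const_smul g⁻¹)).2 h1), ?_⟩
  rw [integral_congr_ae e, h3, ← h2]
  exact hmp.integral_comp (measurableEmbedding_const_smul g⁻¹) fun s => (K (g⁻¹ • t) s : ℂ) * f s

end Const

variable [MeasurableSpace G] [MeasurableInv G] [MeasurableSMul₂ G T] [SFinite m]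
  [SMulInvariantMeasure G T m]

/-- The inner product is an integral over `T` of a jointly measurable function of `(g, t)`. On a
finite-dimensional invariant subspace this weak measurability gives strong measurability of orbits.
-/
theorem measurable_inner_translation (f f' : Lp ℂ 2 m) :
    Measurable fun g : G => inner ℂ f' (translation m g f) := by
  have e : (fun g : G => inner ℂ f' (translation m g f)) =
      fun g : G => ∫ t, inner ℂ (f' t) (f (g⁻¹ • t)) ∂m := by
    funext g
    rw [L2.inner_def]
    refine integral_congr_ae ?_
    filter_upwards [coeFn_translation g f] with t ht
    rw [ht]
  rw [e]
  have hf : StronglyMeasurable fun p : G × T => f (p.1⁻¹ • p.2) :=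
    (Lp.stronglyMeasurable f).comp_measurable (by fun_prop)
  have hf' : StronglyMeasurable fun p : G × T => f' p.2 :=
    (Lp.stronglyMeasurable f').comp_measurable measurable_snd
  have hin : StronglyMeasurable fun p : G × T => (inner ℂ (f' p.2) (f (p.1⁻¹ • p.2)) : ℂ) :=
    hf'.inner hf
  exact hin.integral_prod_right'.measurable

theorem stronglyMeasurable_toRepresentation
    (E : Subrepresentation (translation (G := G) m)) [FiniteDimensional ℂ E.toSubmodule]
    (x : E.toSubmodule) : StronglyMeasurable fun g : G => E.toRepresentation g x := by
  let b := stdOrthonormalBasis ℂ E.toSubmodule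
  have e : (fun g : G => E.toRepresentation g x) =
      fun g => ∑ i, inner ℂ (b i) (E.toRepresentation g x) • b i :=
    funext fun g => (b.sum_repr' _).symm
  rw [e]
  exact Finset.stronglyMeasurable_fun_sum _ fun i _ =>
    (measurable_inner_translation (x : Lp ℂ 2 m) (b i : Lp ℂ 2 m)).stronglyMeasurable.smul_const _

end Translation

/-! ### Identification of `f^π` with the isotypic projection. -/

section Compact

variable {G T : Type*} [Group G] [TopologicalSpace G] [IsTopologicalGroup G] [CompactSpace G]
  [T2Space G] [SecondCountableTopology G] [MeasurableSpace G] [BorelSpace G]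
  (dg : Measure G) [dg.IsHaarMeasure] [IsProbabilityMeasure dg]
  [MeasurableSpace T] [MulAction G T] [MeasurableSMul₂ G T]
  {m : Measure T} [SigmaFinite m] [SMulInvariantMeasure G T m]
  (E : Subrepresentation (translation (G := G) m)) [FiniteDimensional ℂ E.toSubmodule]

include dg in
theorem continuous_toRepresentation_apply (x : E.toSubmodule) :
    Continuous fun g : G => E.toRepresentation g x :=
  Representation.continuous_apply_of_stronglyMeasurable (ρ := E.toRepresentation) dg
    (fun g v => norm_translation g (v : Lp ℂ 2 m)) (stronglyMeasurable_toRepresentation E) x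

include dg in
theorem continuous_toRepresentation :
    Continuous fun p : G × E.toSubmodule => E.toRepresentation p.1 p.2 :=
  Representation.continuous_uncurry_of_norm (ρ := E.toRepresentation)
    (fun g v => norm_translation g (v : Lp ℂ 2 m))
    (continuous_toRepresentation_apply dg E)

include dg in
theorem continuousCoeff_toRepresentation : E.toRepresentation.ContinuousCoeff :=
  Representation.continuousCoeff_of_continuous (continuous_toRepresentation_apply dg E)

omit [T2Space G] [SecondCountableTopology G] in
/-- The pointwise average of translates of `φ` represents the average in the
finite-dimensional translation-invariant space. -/
theorem integral_mul_inv_smul_ae_eq (hE : E.toRepresentation.ContinuousCoeff)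
    {c : G → ℂ} (hc : Continuous c) {φ : T → ℂ} (hφ : MemLp φ 2 m)
    (hφE : hφ.toLp φ ∈ E.toSubmodule) :
    (fun t => ∫ g, c g * φ (g⁻¹ • t) ∂dg) =ᵐ[m]
      ((Representation.weightedAverage dg hE hc ⟨hφ.toLp φ, hφE⟩ : E.toSubmodule) : Lp ℂ 2 m) := by
  set x : E.toSubmodule := ⟨hφ.toLp φ, hφE⟩
  let b := Module.finBasis ℂ E.toSubmodule
  have hexp (y : E.toSubmodule) : ((y : Lp ℂ 2 m) : T → ℂ) =ᵐ[m]
      fun t => ∑ i, b.coord i y * (b i : Lp ℂ 2 m) t := by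
    have h1 : (y : Lp ℂ 2 m) = ∑ i, b.coord i y • (b i : Lp ℂ 2 m) := by
      have := congrArg (Submodule.subtype _) (b.sum_repr y).symm
      rw [map_sum] at this
      exact this
    have h2 : ∀ᵐ t ∂m, ∀ i, (b.coord i y • (b i : Lp ℂ 2 m) : Lp ℂ 2 m) t =
        b.coord i y * (b i : Lp ℂ 2 m) t :=
      ae_all_iff.2 fun i => Lp.coeFn_smul _ _
    rw [h1]
    filter_upwards [Lp.coeFn_finsetSum Finset.univ
      fun i => b.coord i y • (b i : Lp ℂ 2 m), h2] with t h3 h4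
    rw [h3, Finset.sum_apply]
    simp only [h4]
  have hcoord (i) : b.coord i (Representation.weightedAverage dg hE hc x) =
      ∫ g, c g * b.coord i (E.toRepresentation g x) ∂dg := by
    have := (LinearMap.toContinuousLinearMap (b.coord i)).integral_comp_comm
      ((hc.smul (hE.continuous x)).integrable_of_compactSpace (μ := dg))
    rw [Representation.weightedAverage_apply]
    refine this.symm.trans (integral_congr_ae (.of_forall fun g => ?_))
    simp
  -- The expansion of the translate holds for every `g` and almost every `t`, with a null set
  -- depending on `g`. Exchanging the quantifiers needs a measurable set in `G × T`, hence the
  -- measurable `Lp` representative instead of `φ`.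
  have hmeas : MeasurableSet {p : G × T | (x : Lp ℂ 2 m) (p.1⁻¹ • p.2) =
      ∑ i, b.coord i (E.toRepresentation p.1 x) * (b i : Lp ℂ 2 m) p.2} := by
    refine measurableSet_eq_fun ?_ ?_
    · exact (Lp.stronglyMeasurable (x : Lp ℂ 2 m)).measurable.comp (by fun_prop)
    · exact Finset.measurable_fun_sum _ fun i _ =>
        ((hE (b.coord i) x).measurable.comp measurable_fst).mul
          ((Lp.stronglyMeasurable (b i : Lp ℂ 2 m)).measurable.comp measurable_snd)
  have hae : ∀ᵐ g ∂dg, ∀ᵐ t ∂m, (x : Lp ℂ 2 m) (g⁻¹ • t) =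
      ∑ i, b.coord i (E.toRepresentation g x) * (b i : Lp ℂ 2 m) t := by
    refine .of_forall fun g => ?_
    filter_upwards [hexp (E.toRepresentation g x), coeFn_translation g (x : Lp ℂ 2 m)]
      with t h1 h2
    rw [← h1, ← h2]
    rfl
  filter_upwards [(Measure.ae_ae_comm hmeas).1 hae, ae_ae_eq_inv_smul dg hφ.coeFn_toLp,
    hexp (Representation.weightedAverage dg hE hc x)] with t h1 h2 h3
  rw [h3]
  simp only [hcoord]
  have e : (fun g => c g * φ (g⁻¹ • t)) =ᵐ[dg] fun g =>
      ∑ i, c g * b.coord i (E.toRepresentation g x) * (b i : Lp ℂ 2 m) t := by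
    filter_upwards [h1, h2] with g h4 h5
    rw [← h5, h4, Finset.mul_sum]
    simp only [mul_assoc]
  rw [integral_congr_ae e, integral_finsetSum]
  · simp only [integral_mul_const]
  · exact fun i _ => ((hc.mul (hE (b.coord i) x)).integrable_of_compactSpace).mul_const _

-- The dual enters because the average carries the weight `χ(g⁻¹)`, and `χ_π(g) = χ_{π*}(g⁻¹)`.
omit [T2Space G] [SecondCountableTopology G] in
theorem charProj_ae_eq (hE : E.toRepresentation.ContinuousCoeff) (π : UnitaryIrrep G)
    {φ : T → ℂ} (hφ : MemLp φ 2 m) (hφE : hφ.toLp φ ∈ E.toSubmodule) :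
    charProj dg π φ =ᵐ[m] (((Module.finrank ℂ (Module.Dual ℂ (EuclideanSpace ℂ (Fin π.dim))) : ℂ) •
      Representation.weightedAverage dg hE π.continuousCoeff.dual.character_inv
        ⟨hφ.toLp φ, hφE⟩ : E.toSubmodule) : Lp ℂ 2 m) := by
  have h := integral_mul_inv_smul_ae_eq dg E hE π.continuousCoeff.dual.character_inv hφ hφE
  filter_upwards [h, Lp.coeFn_smul (π.dim : ℂ) ((Representation.weightedAverage dg hE
    π.continuousCoeff.dual.character_inv ⟨hφ.toLp φ, hφE⟩ : E.toSubmodule) : Lp ℂ 2 m)]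
    with t h1 h2
  rw [Subspace.dual_finrank_eq, finrank_euclideanSpace_fin, Submodule.coe_smul, h2, Pi.smul_apply,
    ← h1, smul_eq_mul, charProj]
  simp

omit [T2Space G] [SecondCountableTopology G] in
theorem isTypeComponent_charProj (hE : E.toRepresentation.ContinuousCoeff) (π : UnitaryIrrep G)
    {h : ℕ} {τ : Fin h → UnitaryIrrep G} (hτ : IsCanonicalDecomposition E.toRepresentation τ)
    {φ : T → ℂ} (hφ : MemLp φ 2 m) (hφE : hφ.toLp φ ∈ E.toSubmodule) :
    IsTypeComponent E τ π.rep.dual ⟨hφ.toLp φ, hφE⟩ (charProj dg π φ) := by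
  have hπ := π.continuousCoeff.dual
  have hπi : π.rep.dual.IsIrreducible := π.irreducible_rep.dual
  have hproj := charProj_ae_eq dg E hE π hφ hφE
  have h0 (k) (hk : ¬ Equivalent π.rep.dual (τ k).rep) {y : E.toSubmodule}
      (hy : y ∈ isotypic E.toRepresentation (τ k).rep) :
      Representation.weightedAverage dg hE hπ.character_inv y = 0 :=
    Representation.weightedAverage_eq_zero_of_mem_isotypic dg hE (τ k).continuousCoeff hπ
      (τ k).irreducible_rep hπi hk hy
  constructor
  · intro hne
    have hsup := hτ.isInternal.submodule_iSup_eq_top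
    have hz : Representation.weightedAverage dg hE hπ.character_inv ⟨hφ.toLp φ, hφE⟩ = 0 := by
      have hle : (⨆ k, isotypic E.toRepresentation (τ k).rep) ≤
          LinearMap.ker (Representation.weightedAverage dg hE hπ.character_inv) :=
        iSup_le fun k y hy => h0 k (hne k) hy
      rw [hsup] at hle
      exact hle (Submodule.mem_top (x := (⟨hφ.toLp φ, hφE⟩ : E.toSubmodule)))
    rw [hz, smul_zero] at hproj
    exact hproj.trans (Lp.coeFn_zero ℂ 2 m)
  · intro l hl u hu hx
    -- Only the `l`-th term survives: the `τ k` are pairwise inequivalent, so `π*` matches no other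
    -- one.
    rw [hx, map_sum, Finset.sum_eq_single l (fun k _ hkl => h0 k (fun hk =>
      hτ.inequivalent k l hkl (hk.symm.trans hl)) (hu k)) (by simp),
      Representation.smul_weightedAverage_of_mem_isotypic dg hE (τ l).continuousCoeff hπ
        (τ l).irreducible_rep hl (hu l)] at hproj
    exact hproj

include dg in
omit [T2Space G] [SecondCountableTopology G] in
/-- An irreducible representation with real character is equivalent to its dual. -/
theorem UnitaryIrrep.equivalent_dual_of_real (π : UnitaryIrrep G)
    (hreal : ∀ g, (π.rep.character g).im = 0) : Equivalent π.rep.dual π.rep := by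
  refine Representation.equivalent_of_character_eq dg π.continuousCoeff.dual π.continuousCoeff
    π.irreducible_rep.dual π.irreducible_rep fun g => ?_
  rw [Representation.char_dual]
  -- By unitarity each diagonal coefficient in an orthonormal basis is conjugated under `g ↦ g⁻¹`.
  have hconj : π.rep.character g⁻¹ = starRingEnd ℂ (π.rep.character g) := by
    let b := stdOrthonormalBasis ℂ (EuclideanSpace ℂ (Fin π.dim))
    rw [π.rep.character_eq_sum_coord b.toBasis, π.rep.character_eq_sum_coord b.toBasis, map_sum]
    refine Finset.sum_congr rfl fun i _ => ?_
    have e (v) : b.toBasis.coord i v = inner ℂ (b i) v := by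
      simp [b.repr_apply_apply]
    rw [e, e, inner_conj_symm, OrthonormalBasis.coe_toBasis,
      Representation.inner_apply_left_of_norm π.norm_rep]
  rw [hconj]
  exact Complex.conj_eq_iff_im.2 (hreal g)

end Compact

/-! ### Invariance of the covariance. -/

section RandomFunctions

variable {G Ω T : Type*} [Group G] [MulAction G T] [MeasurableSpace Ω]

/-- The product of two coordinates is not a bounded test function. The bounded continuous ones first
identify the two laws on `Fin 2 → ℝ`, and the product is then integrated against the common law. -/
theorem covKernel_smul {P : Measure Ω} [IsProbabilityMeasure P] {X : Ω → T → ℝ}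
    (hX : ∀ t, Measurable fun ω => X ω t) (hinv : IsInvariantLaw G P X) (g : G) (s t : T) :
    covKernel P X (g • s) (g • t) = covKernel P X s t := by
  have hmeas (v : Fin 2 → T) : Measurable fun ω => fun i => X ω (v i) :=
    measurable_pi_lambda _ fun i => hX (v i)
  let v : Fin 2 → T := ![s, t]
  have hlaw : P.map (fun ω => fun i => X ω (g • v i)) = P.map (fun ω => fun i => X ω (v i)) := by
    have (w : Fin 2 → T) : IsProbabilityMeasure (P.map (fun ω => fun i => X ω (w i))) :=
      Measure.isProbabilityMeasure_map (hmeas w).aemeasurable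
    have h1 := this fun i => g • v i
    have h2 := this v
    refine ext_of_forall_integral_eq_of_IsFiniteMeasure fun φ => ?_
    rw [integral_map (hmeas _).aemeasurable φ.continuous.aestronglyMeasurable,
      integral_map (hmeas _).aemeasurable φ.continuous.aestronglyMeasurable]
    exact (hinv 2 φ g v).symm
  have hint (w : Fin 2 → T) : ∫ x, x 0 * x 1 ∂P.map (fun ω => fun i => X ω (w i)) =
      covKernel P X (w 0) (w 1) :=
    integral_map (hmeas w).aemeasurable
      ((continuous_apply 0).mul (continuous_apply 1)).aestronglyMeasurable
  have h := hint fun i => g • v i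
  rw [hlaw, hint v] at h
  exact h.symm

end RandomFunctions

/-! ### Bounds on the number of isotypic components. -/

section Length

variable {G V : Type*} [Group G] [TopologicalSpace G] [AddCommGroup V] [Module ℂ V]
  {ρ : Representation ℂ G V} {h : ℕ} {τ : Fin h → UnitaryIrrep G}

theorem IsCanonicalDecomposition.one_le [Nontrivial V] (hτ : IsCanonicalDecomposition ρ τ) :
    1 ≤ h := by
  by_contra h0
  obtain rfl : h = 0 := by omega
  have htop := hτ.isInternal.submodule_iSup_eq_top
  rw [iSup_of_empty] at htop
  exact bot_ne_top htop

theorem IsCanonicalDecomposition.le_finrank [FiniteDimensional ℂ V]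
    (hτ : IsCanonicalDecomposition ρ τ) : h ≤ Module.finrank ℂ V := by
  classical
  have hcard := hτ.isInternal.submodule_iSupIndep.subtype_ne_bot_le_finrank
  rwa [Fintype.card_congr (Equiv.subtypeUnivEquiv hτ.ne_bot), Fintype.card_fin] at hcard

end Length

end KLProjection

/-! ### The main theorem. -/

theorem proposition11 {G Ω T : Type*}
    [Group G] [TopologicalSpace G] [IsTopologicalGroup G] [CompactSpace G] [T2Space G]
    [SecondCountableTopology G] [MeasurableSpace G] [BorelSpace G]
    (dg : Measure G) [dg.IsHaarMeasure] [IsProbabilityMeasure dg]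
    [MeasurableSpace T] [MulAction G T] [MeasurableSMul₂ G T]
    (m : Measure T) [SigmaFinite m] [SMulInvariantMeasure G T m]
    [MeasurableSpace Ω] (P : Measure Ω) [IsProbabilityMeasure P]
    (X : Ω → T → ℝ)
    (hXmeas : Measurable (Function.uncurry X))
    (hXgauss : IsGaussianProcess (fun t ω => X ω t) P)
    (hXcent : ∀ t, ∫ ω, X ω t ∂P = 0)
    (hXL2 : ∀ ω, MemLp (X ω) 2 m)
    (lam : ℕ → ℝ) (n : ℕ → ℕ) (f : (j : ℕ) → Fin (n j) → T → ℂ)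
    (ξ : (j : ℕ) → Fin (n j) → Ω → ℝ)
    (hspec : IsPositiveSpectrum m (covKernel P X) lam n f)
    (hKL : IsKLExpansion P m X lam n f ξ)
    (hXG : ∀ ω t, MemLp (fun g : G => X ω (g • t)) 2 dg)
    (hfG : ∀ j l t, MemLp (fun g : G => f j l (g • t)) 2 dg) :
    (∀ π : UnitaryIrrep G, ∀ᵐ ω ∂P,
      (∀ N, MemLp (charProj dg π
        (klTruncation lam n f ξ N ω)) 2 m) ∧
      MemLp (charProj dg π (fun t => (X ω t : ℂ))) 2 m ∧
      Tendsto (fun N => eLpNorm (fun t =>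
          charProj dg π (klTruncation lam n f ξ N ω) t
            - charProj dg π (fun s => (X ω s : ℂ)) t) 2 m) atTop (𝓝 0)) ∧
    (IsInvariantLaw G P X → ∀ j, n j ≠ 0 →
      ∃ E : Subrepresentation (translation (G := G) m),
        E.toSubmodule = kernelEigenspace m (covKernel P X) (lam j) ∧
        FiniteDimensional ℂ E.toSubmodule ∧
        Continuous (fun p : G × E.toSubmodule => E.toRepresentation p.1 p.2) ∧
        (∃ (h : ℕ) (τ : Fin h → UnitaryIrrep G),
          IsCanonicalDecomposition E.toRepresentation τ) ∧
        ∀ (h : ℕ) (τ : Fin h → UnitaryIrrep G),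
          IsCanonicalDecomposition E.toRepresentation τ →
          1 ≤ h ∧ h ≤ n j ∧
          (∀ k l, k ≠ l →
            ∀ u ∈ isotypic E.toRepresentation (τ k).rep,
            ∀ v ∈ isotypic E.toRepresentation (τ l).rep, inner ℂ u v = 0) ∧
          ∀ (π : UnitaryIrrep G) (φ : T → ℂ) (hφ : MemLp φ 2 m)
            (hφE : hφ.toLp φ ∈ E.toSubmodule),
            (∀ᵐ t ∂m, Integrable (fun g : G => π.rep.character g * φ (g⁻¹ • t)) dg) ∧
            MemLp (charProj dg π φ) 2 m ∧
            IsTypeComponent E τ π.rep.dual ⟨hφ.toLp φ, hφE⟩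
              (charProj dg π φ) ∧
            ((∀ g, (π.rep.character g).im = 0) →
              IsTypeComponent E τ π.rep ⟨hφ.toLp φ, hφE⟩
                (charProj dg π φ))) := by
  constructor
  · intro π
    filter_upwards [hKL.tendsto] with ω hω
    have hN (N) : MemLp (klTruncation lam n f ξ N ω) 2 m :=
      memLp_finsetSum _ fun j _ =>
        (memLp_finsetSum _ fun l _ => (hspec.memLp j l).const_mul _).const_mul _
    have hX : MemLp (fun t => (X ω t : ℂ)) 2 m := (hXL2 ω).ofReal
    exact ⟨fun N => memLp_charProj dg π (hN N), memLp_charProj dg π hX,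
      tendsto_eLpNorm_charProj_sub dg π hN hX hω⟩
  · intro hinv j hj
    have hK : ∀ (g : G) s t, covKernel P X (g • s) (g • t) = covKernel P X s t :=
      covKernel_smul (fun t => hXmeas.comp (measurable_id.prodMk measurable_const)) hinv
    let E : Subrepresentation (translation (G := G) m) :=
      ⟨kernelEigenspace m (covKernel P X) (lam j), fun g _ hf =>
        translation_mem_kernelEigenspace hK (lam j) g hf⟩
    have hspan := hspec.span_eq j hj
    have hfin : FiniteDimensional ℂ E.toSubmodule := by
      change FiniteDimensional ℂ (kernelEigenspace m (covKernel P X) (lam j))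
      rw [← hspan]
      exact FiniteDimensional.span_of_finite ℂ (Set.finite_range _)
    have hrank : Module.finrank ℂ E.toSubmodule = n j := by
      change Module.finrank ℂ (kernelEigenspace m (covKernel P X) (lam j)) = n j
      rw [← hspan, finrank_span_eq_card (hspec.orthonormal j).linearIndependent, Fintype.card_fin]
    have hcont := continuous_toRepresentation dg E
    have hnorm (g : G) (v : E.toSubmodule) : ‖E.toRepresentation g v‖ = ‖v‖ :=
      norm_translation g (v : Lp ℂ 2 m)
    have hE := continuousCoeff_toRepresentation dg E
    refine ⟨E, rfl, hfin, hcont, Representation.exists_isCanonicalDecomposition hcont hnorm,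
      fun h τ hτ => ⟨?_, ?_, ?_, ?_⟩⟩
    · have : Nontrivial E.toSubmodule := Module.nontrivial_of_finrank_pos (R := ℂ) (by omega)
      exact hτ.one_le
    · exact hτ.le_finrank.trans_eq hrank
    · intro k l hkl u hu v hv
      exact Submodule.isOrtho_iff_inner_eq.1 (Representation.isotypic_isOrtho hnorm
        (τ k).irreducible_rep (τ l).irreducible_rep (hτ.inequivalent k l hkl)) u hu v hv
    · intro π φ hφ hφE
      have hcomp := isTypeComponent_charProj dg E hE π hτ hφ hφE
      refine ⟨ae_integrable_mul_inv_smul dg π.continuousCoeff.character hφ,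
        memLp_charProj dg π hφ, hcomp, fun hreal => ?_⟩
      have hdual := π.equivalent_dual_of_real dg hreal
      exact ⟨fun hne => hcomp.1 fun l hl => hne l (hdual.symm.trans hl),
        fun l hl => hcomp.2 l (hdual.trans hl)⟩
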